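/- Let $G$ be a finite group of odd order $n$, and put $n^*=(-1)^{(n-1)/2}n$. For an integer $a$ prime to $n$, the map $g\mapsto g^a$ induces a permutation of the set of conjugacy classes of $G$. Let $\left(\frac{a}{G}\right)$ be $1$ if this permutation is even and $-1$ if it is odd, and put $\left(\frac{a}{G}\right)=0$ for integers $a$ with $\gcd(a,n)\neq 1$. Call a conjugacy class $C$ real if $C^{-1}=C$ and complex otherwise, let $C_1,\dots,C_{r_1}$ be the real conjugacy classes and $2r_2$ the number of complex ones, and define the discriminant of $G$ by $$d(G)=(-1)^{r_2}\,|G|^{r_1}\prod_{j=1}^{r_1}|C_j|^{-1}.$$ For a non-zero integer $d\equiv 0,1 \pmod 4$ let $\left(\frac{d}{\cdot}\right)$ be the Kronecker symbol: it extends the Jacobi symbol (whose lower entry is odd and positive) multiplicatively to all non-zero integers, with $\left(\frac{d}{2}\right)=0$, $1$, $-1$ according as $d$ is even, $d\equiv 1\pmod 8$, $d\equiv 5\pmod 8$, and with $\left(\frac{d}{-1}\right)$ the sign of $d$; moreover $\left(\frac{d}{0}\right)=0$ if $d\ne 1$, and $\left(\frac{1}{0}\right)=1$. Then: 1. $d(G)=n^*$;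 2. $\left(\frac{a}{G}\right)=\left(\frac{n^*}{a}\right)$ for every integer $a$; 3. $\left(\frac{\cdot}{G}\right)$ is trivial, that is, $\left(\frac{a}{G}\right)=1$ for every integer $a$ prime to $n$, if and only if $n$ is a square. -/

import Mathlib

/-- The Kronecker symbol `(d / 2)`: it is `0` for even `d`, `1` for `d ≡ ±1 (mod 8)` and `-1` for
`d ≡ ±3 (mod 8)`. An odd discriminant `d ≡ 1 (mod 4)` is `1` or `5` modulo `8`. -/
def kroneckerTwo (d : ℤ) : ℤ :=
  if Even d then 0 else if d % 8 = 1 ∨ d % 8 = 7 then 1 else -1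

/-- The Kronecker symbol `(d / -1)`: the sign of `d`, for `d ≠ 0`. -/
def kroneckerNegOne (d : ℤ) : ℤ :=
  if d < 0 then -1 else 1

/-- The Kronecker symbol `(d / a)`. For `a = ± 2 ^ k * b` with `b` odd and positive, it is
`(d / ±1) * (d / 2) ^ k * (d / b)`, where `(d / b)` is the Jacobi symbol. For `a = 0` it is `1` if
`d = ±1` (among discriminants `d ≡ 0, 1 (mod 4)` this is `d = 1` only) and `0` otherwise. -/
def kroneckerSymbol (d a : ℤ) : ℤ :=
  if a = 0 then (if d = 1 ∨ d = -1 then 1 else 0)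
  else (if a < 0 then kroneckerNegOne d else 1) *
    kroneckerTwo d ^ (a.natAbs.factorization 2) *
    jacobiSym d (a.natAbs / 2 ^ (a.natAbs.factorization 2))

/-- `n* = (-1) ^ ((n - 1) / 2) * n`, meant for odd `n`. -/
def nStar (n : ℕ) : ℤ := (-1) ^ ((n - 1) / 2) * (n : ℤ)

/-- The map on conjugacy classes that sends the class of `g` to the class of `g ^ a`. -/
def conjClassesZPow (G : Type*) [Group G] (a : ℤ) : ConjClasses G → ConjClasses G :=
  Quotient.map (fun g : G => g ^ a) (by
    intro g h hgh
    obtain ⟨c, hc⟩ := isConj_iff.1 (show IsConj g h from hgh)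
    exact isConj_iff.2 ⟨c, by rw [← conj_zpow, hc]⟩)

theorem conjClassesZPow_mk {G : Type*} [Group G] (a : ℤ) (g : G) :
    conjClassesZPow G a (ConjClasses.mk g) = ConjClasses.mk (g ^ a) := rfl

theorem zpow_gcdA_of_coprime {G : Type*} [Group G] {a : ℤ}
    (ha : Int.gcd a (Nat.card G) = 1) (g : G) :
    g ^ (a * Int.gcdA a (Nat.card G)) = g := by
  have h := Int.gcd_eq_gcd_ab a (Nat.card G)
  rw [ha] at h
  have h2 : a * Int.gcdA a (Nat.card G) = 1 - (Nat.card G : ℤ) * Int.gcdB a (Nat.card G) := by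
    push_cast at h; linarith
  rw [h2, zpow_sub, zpow_mul, zpow_natCast, pow_card_eq_one']
  simp

/-- For `a` prime to the order of `G`, the permutation of the conjugacy classes of `G` induced by
`g ↦ g ^ a`. -/
noncomputable def conjClassesPerm (G : Type*) [Group G] (a : ℤ) (ha : Int.gcd a (Nat.card G) = 1) :
    Equiv.Perm (ConjClasses G) where
  toFun := conjClassesZPow G a
  invFun := conjClassesZPow G (Int.gcdA a (Nat.card G))
  left_inv := by
    intro C
    induction C using Quotient.inductionOn with
    | h g =>
      change ConjClasses.mk ((g ^ a) ^ Int.gcdA a (Nat.card G)) = ConjClasses.mk g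
      rw [← zpow_mul, zpow_gcdA_of_coprime ha]
  right_inv := by
    intro C
    induction C using Quotient.inductionOn with
    | h g =>
      change ConjClasses.mk ((g ^ Int.gcdA a (Nat.card G)) ^ a) = ConjClasses.mk g
      rw [← zpow_mul, mul_comm, zpow_gcdA_of_coprime ha]

open Classical in
/-- The quadratic symbol `(a / G)` of a finite group: `0` if `a` is not prime to `|G|`, and
otherwise the sign of the permutation of the conjugacy classes induced by `g ↦ g ^ a`. -/
noncomputable def quadraticSymbol (G : Type*) [Group G] [Finite G] (a : ℤ) : ℤ :=
  letI : Fintype (ConjClasses G) := Fintype.ofFinite _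
  if ha : Int.gcd a (Nat.card G) = 1 then
    ((Equiv.Perm.sign (conjClassesPerm G a ha) : ℤˣ) : ℤ)
  else 0

/-- A conjugacy class `C` is real if its image under `g ↦ g⁻¹` is `C`. -/
def IsRealClass {G : Type*} [Group G] (C : ConjClasses G) : Prop :=
  (fun g : G => g⁻¹) '' C.carrier = C.carrier

/-- The number `r₁` of real conjugacy classes. -/
noncomputable def numRealClasses (G : Type*) [Group G] : ℕ :=
  Nat.card {C : ConjClasses G // IsRealClass C}

/-- Half the number of complex conjugacy classes, `r₂`. Complex classes come in pairs
`C ≠ C⁻¹`, so the division is exact. -/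
noncomputable def numComplexPairs (G : Type*) [Group G] : ℕ :=
  Nat.card {C : ConjClasses G // ¬ IsRealClass C} / 2

/-- The discriminant `d(G) = (-1) ^ r₂ * |G| ^ r₁ * ∏ |C|⁻¹`, the product being over the real
conjugacy classes `C`, as a rational number. -/
noncomputable def groupDiscriminant (G : Type*) [Group G] [Finite G] : ℚ :=
  (-1) ^ numComplexPairs G * (Nat.card G : ℚ) ^ numRealClasses G *
    ∏ᶠ C : {C : ConjClasses G // IsRealClass C}, (Nat.card C.1.carrier : ℚ)⁻¹

/-!
Let `q` be a prime not dividing `2 |G|` and `K` an algebraic closure of `𝔽_q`. The traces of the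
blocks of `K[G]` form a square character table `X`. Computing the trace of `x ↦ g x h` on `K[G]` in
the basis `G` and block by block shows that `Xᵀ X` is the diagonal matrix of the centralizer orders
with its columns permuted by `C ↦ C⁻¹`, so `(det X) ^ 2 = (-1 / G) * ∏ |C_G(C)|`. As
`tr (A ^ q) = (tr A) ^ q`, Frobenius permutes the columns of `X` like `g ↦ g ^ q`, so
`(det X) ^ q = (q / G) * det X`. Hence `(q / G)` is the Legendre symbol of `(det X) ^ 2` modulo `q`.

In odd order the only real class is `{1}`, and the other classes come in pairs `C`, `C⁻¹` with equal
centralizer orders; so `∏ |C_G(C)|` is `n` times a square prime to `q`, while the class equation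
modulo `4` gives `(-1 / G) = (-1) ^ ((n - 1) / 2)`. Dirichlet's theorem on primes in arithmetic
progressions and quadratic reciprocity turn `(q / G) = (n* / q)` into
`(a / G) = (a / n) = (n* / a)`.
-/

section NumberTheory

variable {n : ℕ}

theorem nStar_emod_eight (hn : Odd n) :
    (n % 8 = 1 ∧ nStar n % 8 = 1) ∨ (n % 8 = 3 ∧ nStar n % 8 = 5) ∨
      (n % 8 = 5 ∧ nStar n % 8 = 5) ∨ (n % 8 = 7 ∧ nStar n % 8 = 1) := by
  rw [Nat.odd_iff] at hn
  rcases Nat.even_or_odd ((n - 1) / 2) with h | h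
  · rw [nStar, h.neg_one_pow]
    rw [Nat.even_iff] at h
    omega
  · rw [nStar, h.neg_one_pow]
    rw [Nat.odd_iff] at h
    omega

theorem kroneckerTwo_nStar (hn : Odd n) : kroneckerTwo (nStar n) = jacobiSym 2 n := by
  have not_even : ¬ Even (nStar n) := by
    rw [Int.even_iff]
    have := nStar_emod_eight hn
    omega
  rw [jacobiSym.at_two hn, ZMod.χ₈_nat_eq_if_mod_eight, kroneckerTwo, if_neg not_even]
  rcases nStar_emod_eight hn with h | h | h | h <;> simp [h, Nat.odd_iff.1 hn]

theorem nStar_eq_neg_one_pow_mul (hn : Odd n) : nStar n = (-1) ^ (n / 2) * n := by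
  obtain ⟨k, rfl⟩ := hn
  rw [nStar]
  congr 2
  omega

theorem kroneckerNegOne_nStar (hn : Odd n) : kroneckerNegOne (nStar n) = jacobiSym (-1) n := by
  have hpos := hn.pos
  rw [jacobiSym.at_neg_one hn, ZMod.χ₄_eq_neg_one_pow (Nat.odd_iff.1 hn), kroneckerNegOne,
    nStar_eq_neg_one_pow_mul hn]
  rcases neg_one_pow_eq_or ℤ (n / 2) with h | h <;> rw [h]
  · rw [if_neg (by omega)]
  · rw [if_pos (by omega)]

theorem jacobiSym_nStar {b : ℕ} (hn : Odd n) (hb : Odd b) :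
    jacobiSym (nStar n) b = jacobiSym b n := by
  have neg_one_pow_sq : ((-1 : ℤ) ^ (b / 2 * (n / 2))) ^ 2 = 1 := by
    rw [← pow_mul, pow_mul', neg_one_sq, one_pow]
  rw [nStar_eq_neg_one_pow_mul hn, jacobiSym.mul_left, jacobiSym.quadratic_reciprocity hn hb,
    jacobiSym.pow_left, jacobiSym.at_neg_one hb, ZMod.χ₄_eq_neg_one_pow (Nat.odd_iff.1 hb),
    ← pow_mul, ← mul_assoc, mul_comm (n / 2), ← sq, neg_one_pow_sq, one_mul]

theorem kroneckerTwo_pow_mul_jacobiSym_nStar (hn : Odd n) {m : ℕ} (hm : m ≠ 0) :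
    kroneckerTwo (nStar n) ^ m.factorization 2 *
      jacobiSym (nStar n) (m / 2 ^ m.factorization 2) = jacobiSym m n := by
  have odd_ordCompl : Odd (m / 2 ^ m.factorization 2) := by
    rw [← Nat.not_even_iff_odd, even_iff_two_dvd]
    exact Nat.not_dvd_ordCompl Nat.prime_two hm
  rw [kroneckerTwo_nStar hn, jacobiSym_nStar hn odd_ordCompl, ← jacobiSym.pow_left,
    ← jacobiSym.mul_left]
  exact_mod_cast congrArg (fun k : ℕ => jacobiSym k n) (Nat.ordProj_mul_ordCompl_eq_self m 2)

theorem nStar_eq_one_or_neg_one_iff : nStar n = 1 ∨ nStar n = -1 ↔ n = 1 := by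
  rw [← Int.natAbs_eq_natAbs_iff (b := 1), nStar]
  simp [Int.natAbs_mul, Int.natAbs_pow]

theorem kroneckerSymbol_nStar (hn : Odd n) (a : ℤ) :
    kroneckerSymbol (nStar n) a = jacobiSym a n := by
  rcases eq_or_ne a 0 with rfl | ha
  · rw [kroneckerSymbol, if_pos rfl]
    simp only [nStar_eq_one_or_neg_one_iff]
    split_ifs with h
    · rw [h, jacobiSym.one_right]
    · rw [jacobiSym.zero_left (by have := hn.pos; omega)]
  · rw [kroneckerSymbol, if_neg ha, mul_assoc,
      kroneckerTwo_pow_mul_jacobiSym_nStar hn (Int.natAbs_ne_zero.2 ha)]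
    split_ifs with hneg
    · rw [kroneckerNegOne_nStar hn, ← jacobiSym.mul_left, Int.ofNat_natAbs_of_nonpos hneg.le,
        neg_one_mul, neg_neg]
    · rw [one_mul, Int.natAbs_of_nonneg (not_lt.1 hneg)]

theorem isSquare_of_even_factorization (h : ∀ p, Even (n.factorization p)) : IsSquare n := by
  rcases eq_or_ne n 0 with rfl | hn
  · exact IsSquare.zero
  rw [← Nat.prod_factorization_pow_eq_self hn]
  exact Finset.isSquare_prod _ fun p _ => (h p).isSquare_pow p

theorem exists_jacobiSym_prime_pow_mul_eq_neg_one {p m k : ℕ} (hp : p.Prime) (hp2 : p ≠ 2)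
    (hm : m ≠ 0) (hpm : p.Coprime m) (hk : Odd k) : ∃ a : ℤ, jacobiSym a (p ^ k * m) = -1 := by
  have : Fact p.Prime := ⟨hp⟩
  obtain ⟨u, hu⟩ := FiniteField.exists_nonsquare (F := ZMod p) (by rwa [ZMod.ringChar_zmod_n])
  obtain ⟨a, hap, ham⟩ := Nat.chineseRemainder hpm u.val 1
  have jacobiSym_p : jacobiSym a p = -1 := by
    have cast_eq : ((a : ℤ) : ZMod p) = u := by
      rw [Int.cast_natCast, (ZMod.natCast_eq_natCast_iff _ _ _).2 hap, ZMod.natCast_zmod_val]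
    rwa [ZMod.nonsquare_iff_jacobiSym_eq_neg_one, cast_eq]
  have jacobiSym_m : jacobiSym a m = 1 := by
    rw [jacobiSym.mod_left' (a₂ := 1) (by exact_mod_cast ham), jacobiSym.one_left]
  refine ⟨a, ?_⟩
  rw [jacobiSym.mul_right' _ (pow_ne_zero _ hp.ne_zero) hm, jacobiSym.pow_right, jacobiSym_p,
    jacobiSym_m, hk.neg_one_pow, mul_one]

theorem forall_jacobiSym_eq_one_iff_isSquare (hn : Odd n) :
    (∀ a : ℤ, Int.gcd a n = 1 → jacobiSym a n = 1) ↔ IsSquare n := by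
  constructor
  · refine fun h => isSquare_of_even_factorization fun p => ?_
    by_contra! hp
    rw [Nat.not_even_iff_odd] at hp
    have hp_mem : p ∈ n.primeFactors := by
      rw [← Nat.support_factorization, Finsupp.mem_support_iff]
      exact hp.pos.ne'
    have hp_prime := Nat.prime_of_mem_primeFactors hp_mem
    obtain ⟨a, ha⟩ := exists_jacobiSym_prime_pow_mul_eq_neg_one hp_prime
      (hn.ne_two_of_dvd_nat (Nat.dvd_of_mem_primeFactors hp_mem))
      (Nat.ordCompl_pos p hn.pos.ne').ne' (Nat.coprime_ordCompl hp_prime hn.pos.ne') hp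
    rw [Nat.ordProj_mul_ordCompl_eq_self] at ha
    have gcd_eq_one : Int.gcd a n = 1 := by
      by_contra hne
      simp [jacobiSym.eq_zero_iff.2 ⟨hn.pos.ne', hne⟩] at ha
    rw [h a gcd_eq_one] at ha
    norm_num at ha
  · rintro ⟨m, rfl⟩ a ha
    have hm : m ≠ 0 := by
      rintro rfl
      simp at hn
    have gcd_eq_one : Int.gcd a m = 1 := by
      rw [← Nat.dvd_one, ← ha]
      exact Int.gcd_dvd_gcd_of_dvd_right _ (by push_cast; exact dvd_mul_right _ _)
    rw [jacobiSym.mul_right' _ hm hm, ← sq, jacobiSym.sq_one gcd_eq_one]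

end NumberTheory

section Frobenius

open Polynomial

variable {R n : Type*} [CommRing R] [Fintype n] [DecidableEq n] (p : ℕ) [hp : Fact p.Prime]
  [CharP R p] (M : Matrix n n R)

theorem charmatrix_pow_char :
    M.charmatrix ^ p = (expand R p).mapMatrix (M ^ p).charmatrix := by
  cases isEmpty_or_nonempty n
  · exact Subsingleton.elim _ _
  rw [Matrix.charmatrix, Matrix.charmatrix,
    sub_pow_char_of_commute p (Matrix.scalar_commute _ (Commute.all X) _), ← map_pow, ← map_pow,
    map_sub]
  congr 1
  · ext1 i j
    rcases eq_or_ne i j with rfl | hij <;> simp [*]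
  · ext1 i j
    simp

theorem charpoly_pow_char : (M ^ p).charpoly = M.charpoly.map (frobenius R p) := by
  refine expand_injective hp.out.pos ?_
  calc expand R p (M ^ p).charpoly
      = (M.charmatrix ^ p).det := by
        rw [Matrix.charpoly, AlgHom.map_det, charmatrix_pow_char]
    _ = expand R p (M.charpoly.map (frobenius R p)) := by
        rw [Matrix.det_pow, ← Matrix.charpoly, ← map_frobenius_expand, map_expand]

theorem trace_pow_char : (M ^ p).trace = M.trace ^ p := by
  cases isEmpty_or_nonempty n
  · simp [Matrix.trace, hp.out.ne_zero]
  · have : Nontrivial R := CharP.nontrivial_of_char_ne_one hp.out.ne_one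
    rw [Matrix.trace_eq_neg_charpoly_coeff, Matrix.trace_eq_neg_charpoly_coeff, charpoly_pow_char,
      coeff_map, ← map_neg, frobenius_def]

end Frobenius

section Trace

variable {R : Type*} [CommRing R]

theorem trace_piMap {ι : Type*} [Fintype ι] {M : ι → Type*}
    [∀ i, AddCommGroup (M i)] [∀ i, Module R (M i)] [∀ i, Module.Free R (M i)]
    [∀ i, Module.Finite R (M i)] (f : ∀ i, M i →ₗ[R] M i) :
    LinearMap.trace R (∀ i, M i) (LinearMap.piMap f) = ∑ i, LinearMap.trace R (M i) (f i) := by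
  classical
  let b i := Module.Free.chooseBasis R (M i)
  simp_rw [LinearMap.trace_eq_matrix_trace R (Pi.basis b), LinearMap.trace_eq_matrix_trace R (b _),
    Matrix.trace, Fintype.sum_sigma, Matrix.diag_apply, LinearMap.toMatrix_apply]
  simp [Pi.basis_apply]

theorem trace_mulLeftRight_matrix {n : Type*} [Fintype n] (A B : Matrix n n R) :
    LinearMap.trace R _ (LinearMap.mulLeftRight R (A, B)) = A.trace * B.trace := by
  classical
  rw [LinearMap.trace_eq_matrix_trace R (Matrix.stdBasis R n n), Matrix.trace,
    Fintype.sum_prod_type, Matrix.trace, Matrix.trace, Finset.sum_mul_sum]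
  simp [LinearMap.toMatrix_apply, Matrix.stdBasis, Matrix.mul_apply, Pi.single_apply, ite_apply]

theorem trace_mulLeftRight_monoidAlgebra {G : Type*} [Monoid G] [Fintype G] [DecidableEq G]
    (g h : G) :
    LinearMap.trace R _ (LinearMap.mulLeftRight R
      (MonoidAlgebra.of R G g, MonoidAlgebra.of R G h)) = Fintype.card {x // g * x * h = x} := by
  classical
  rw [LinearMap.trace_eq_matrix_trace R (MonoidAlgebra.basis G R), Matrix.trace]
  simp [LinearMap.toMatrix_apply, MonoidAlgebra.basis, MonoidAlgebra.single_mul_single,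
    Finsupp.single_apply, Fintype.card_subtype]

end Trace

section ConjugacyClasses

variable {G : Type*} [Group G]

theorem card_carrier_mul_card_centralizer (g : G) :
    Nat.card (ConjClasses.mk g).carrier * Nat.card (Subgroup.centralizer {g}) = Nat.card G := by
  rw [Subgroup.nat_card_centralizer_nat_card_stabilizer, ← ConjAct.orbit_eq_carrier_conjClasses,
    Nat.card_coe_set_eq, ← MulAction.index_stabilizer, Subgroup.index_mul_card]
  rfl

theorem card_carrier_dvd_card (C : ConjClasses G) : Nat.card C.carrier ∣ Nat.card G := by
  obtain ⟨g, rfl⟩ := C.exists_rep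
  exact Dvd.intro _ (card_carrier_mul_card_centralizer g)

theorem card_carrier_one : Nat.card (1 : ConjClasses G).carrier = 1 := by
  have carrier_eq : (1 : ConjClasses G).carrier = {1} := by
    ext g
    rw [ConjClasses.mem_carrier_iff_mk_eq, ConjClasses.one_eq_mk_one,
      ConjClasses.mk_eq_mk_iff_isConj, isConj_one_left, Set.mem_singleton_iff]
  rw [carrier_eq, Nat.card_unique]

/-- The order of the centralizer of an element of the class `C`, written as `|G| / |C|` so that no
representative has to be chosen. -/
noncomputable def centralizerCard (C : ConjClasses G) : ℕ :=
  Nat.card G / Nat.card C.carrier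

theorem centralizerCard_mk [Finite G] (g : G) :
    centralizerCard (ConjClasses.mk g) = Nat.card (Subgroup.centralizer {g}) := by
  rw [centralizerCard, ← card_carrier_mul_card_centralizer g]
  have : Nonempty (ConjClasses.mk g).carrier := ⟨⟨g, ConjClasses.mem_carrier_mk⟩⟩
  exact Nat.mul_div_cancel_left _ Nat.card_pos

theorem centralizerCard_one : centralizerCard (1 : ConjClasses G) = Nat.card G := by
  rw [centralizerCard, card_carrier_one, Nat.div_one]

theorem centralizerCard_dvd_card (C : ConjClasses G) : centralizerCard C ∣ Nat.card G :=
  Nat.div_dvd_of_dvd (card_carrier_dvd_card C)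

theorem conjClassesZPow_congr {a b : ℤ} (h : a ≡ b [ZMOD Nat.card G]) :
    conjClassesZPow G a = conjClassesZPow G b := by
  ext ⟨g⟩
  change ConjClasses.mk (g ^ a) = ConjClasses.mk (g ^ b)
  rw [zpow_eq_zpow_iff_modEq.2 (h.of_dvd (by exact_mod_cast orderOf_dvd_natCard g))]

theorem conjClassesZPow_neg_one_mk (g : G) :
    conjClassesZPow G (-1) (ConjClasses.mk g) = ConjClasses.mk g⁻¹ := by
  rw [conjClassesZPow_mk, zpow_neg_one]

theorem conjClassesZPow_neg_one_involutive : Function.Involutive (conjClassesZPow G (-1)) := by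
  rintro ⟨g⟩
  change ConjClasses.mk ((g ^ (-1 : ℤ)) ^ (-1 : ℤ)) = ConjClasses.mk g
  rw [zpow_neg_one, zpow_neg_one, inv_inv]

theorem conjClassesZPow_neg_one_one : conjClassesZPow G (-1) 1 = 1 := by
  rw [ConjClasses.one_eq_mk_one, conjClassesZPow_mk, one_zpow]

theorem carrier_conjClassesZPow_neg_one (C : ConjClasses G) :
    (conjClassesZPow G (-1) C).carrier = (fun g => g⁻¹) '' C.carrier := by
  ext g
  rw [Set.image_inv_eq_inv, Set.mem_inv, ConjClasses.mem_carrier_iff_mk_eq,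
    ConjClasses.mem_carrier_iff_mk_eq, ← conjClassesZPow_neg_one_mk,
    conjClassesZPow_neg_one_involutive.eq_iff]

theorem card_carrier_conjClassesZPow_neg_one (C : ConjClasses G) :
    Nat.card (conjClassesZPow G (-1) C).carrier = Nat.card C.carrier := by
  rw [carrier_conjClassesZPow_neg_one]
  exact Nat.card_image_of_injective inv_injective _

theorem centralizerCard_conjClassesZPow_neg_one (C : ConjClasses G) :
    centralizerCard (conjClassesZPow G (-1) C) = centralizerCard C := by
  rw [centralizerCard, card_carrier_conjClassesZPow_neg_one, centralizerCard]

theorem conjClasses_carrier_injective :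
    Function.Injective (ConjClasses.carrier : ConjClasses G → Set G) := by
  rintro ⟨g⟩ D h
  exact ConjClasses.mem_carrier_iff_mk_eq.1 (h ▸ ConjClasses.mem_carrier_mk)

theorem isRealClass_iff {C : ConjClasses G} : IsRealClass C ↔ conjClassesZPow G (-1) C = C := by
  rw [IsRealClass, ← carrier_conjClassesZPow_neg_one, conjClasses_carrier_injective.eq_iff]

theorem card_mul_mul_eq_self [Finite G] [DecidableEq (ConjClasses G)] (g h : G) :
    Nat.card {x // g * x * h = x} =
      if ConjClasses.mk h = conjClassesZPow G (-1) (ConjClasses.mk g) then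
        centralizerCard (ConjClasses.mk g) else 0 := by
  rw [conjClassesZPow_neg_one_mk, centralizerCard_mk]
  split_ifs with hgh
  · obtain ⟨c, hc⟩ := isConj_iff.1 (ConjClasses.mk_eq_mk_iff_isConj.1 hgh)
    have h_eq : h = c⁻¹ * g⁻¹ * c := by
      rw [← hc]
      group
    refine Nat.card_congr ((Equiv.mulRight c⁻¹).subtypeEquiv fun x => ?_)
    rw [Equiv.coe_mulRight, Subgroup.mem_centralizer_singleton_iff, h_eq, ← mul_assoc, ← mul_assoc,
      ← eq_mul_inv_iff_mul_eq, mul_inv_eq_iff_eq_mul, eq_comm, mul_assoc g]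
  · rw [Nat.card_eq_zero]
    refine Or.inl ⟨fun ⟨x, hx⟩ => hgh (ConjClasses.mk_eq_mk_iff_isConj.2 (isConj_iff.2 ⟨x, ?_⟩))⟩
    rw [mul_inv_eq_iff_eq_mul, eq_inv_mul_iff_mul_eq, ← mul_assoc, hx]

end ConjugacyClasses

section OddOrder

variable {G : Type*} [Group G]

theorem exists_sq_pow_eq_self (hodd : Odd (Nat.card G)) (g : G) : ∃ m : ℕ, (g ^ 2) ^ m = g :=
  exists_pow_eq_self_of_coprime
    (Nat.coprime_two_left.2 (hodd.of_dvd_nat (orderOf_dvd_natCard g)))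

theorem eq_one_of_isConj_inv (hodd : Odd (Nat.card G)) {g : G} (h : IsConj g g⁻¹) : g = 1 := by
  obtain ⟨c, hc⟩ := h
  have commute_sq : Commute ((c : G) ^ 2) g := by
    have := hc.inv_right.mul_left hc
    rwa [inv_inv, ← sq] at this
  obtain ⟨m, hm⟩ := exists_sq_pow_eq_self hodd (c : G)
  have commute : Commute (c : G) g := hm ▸ commute_sq.pow_left m
  have sq_eq_one : g ^ 2 = 1 := by
    rw [sq, mul_eq_one_iff_eq_inv]
    exact mul_right_cancel (commute.eq.symm.trans hc.eq)
  obtain ⟨m, hm⟩ := exists_sq_pow_eq_self hodd g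
  rw [← hm, sq_eq_one, one_pow]

theorem conjClassesZPow_neg_one_eq_self_iff (hodd : Odd (Nat.card G)) {C : ConjClasses G} :
    conjClassesZPow G (-1) C = C ↔ C = 1 := by
  refine ⟨fun h => ?_, fun h => h ▸ conjClassesZPow_neg_one_one⟩
  obtain ⟨g, rfl⟩ := C.exists_rep
  change conjClassesZPow G (-1) (ConjClasses.mk g) = ConjClasses.mk g at h
  rw [conjClassesZPow_neg_one_mk, ConjClasses.mk_eq_mk_iff_isConj] at h
  rw [eq_one_of_isConj_inv hodd h.symm]
  rfl

theorem prod_conjClasses_eq_apply_one [Fintype (ConjClasses G)] (hodd : Odd (Nat.card G))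
    {M : Type*} [CommMonoid M] (f : ConjClasses G → M)
    (hf : ∀ C, C ≠ 1 → f C * f (conjClassesZPow G (-1) C) = 1) : ∏ C, f C = f 1 := by
  classical
  rw [← Finset.mul_prod_erase _ _ (Finset.mem_univ 1),
    Finset.prod_involution (fun C _ => conjClassesZPow G (-1) C), mul_one]
  · exact fun C hC => hf C (Finset.ne_of_mem_erase hC)
  · exact fun C hC _ h =>
      Finset.ne_of_mem_erase hC ((conjClassesZPow_neg_one_eq_self_iff hodd).1 h)
  · intro C hC
    rw [Finset.mem_erase, Ne, conjClassesZPow_neg_one_involutive.eq_iff,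
      conjClassesZPow_neg_one_one]
    exact ⟨Finset.ne_of_mem_erase hC, Finset.mem_univ _⟩
  · exact fun C _ => conjClassesZPow_neg_one_involutive C

theorem card_conjClasses_modEq_card (hodd : Odd (Nat.card G)) :
    Nat.card (ConjClasses G) ≡ Nat.card G [MOD 4] := by
  have : Finite G := Nat.finite_of_card_ne_zero hodd.pos.ne'
  have := Fintype.ofFinite (ConjClasses G)
  have sum_sub_one : ∑ C : ConjClasses G, ((Nat.card C.carrier : ZMod 4) - 1) = 0 := by
    have prod_eq := prod_conjClasses_eq_apply_one hodd
      (fun C => Multiplicative.ofAdd ((Nat.card C.carrier : ZMod 4) - 1)) fun C _ => by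
        -- The classes `C` and `C⁻¹` contribute `2 (|C| - 1)`, and `|C|` is odd.
        obtain ⟨k, hk⟩ := hodd.of_dvd_nat (card_carrier_dvd_card C)
        rw [card_carrier_conjClassesZPow_neg_one, ← ofAdd_add, hk, ofAdd_eq_one]
        push_cast
        ring_nf
        exact mul_eq_zero_of_right _ (by decide)
    rwa [← ofAdd_sum, card_carrier_one, Nat.cast_one, sub_self, ofAdd_zero, ofAdd_eq_one] at prod_eq
  have class_equation : ∑ C : ConjClasses G, Nat.card C.carrier = Nat.card G := by
    rw [← finsum_eq_sum_of_fintype]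
    exact Group.sum_card_conj_classes_eq_card G
  rw [← ZMod.natCast_eq_natCast_iff, ← class_equation, Nat.card_eq_fintype_card,
    Nat.cast_sum, eq_comm, ← sub_eq_zero, ← sum_sub_one, Finset.sum_sub_distrib, Finset.sum_const,
    Finset.card_univ, nsmul_one]

theorem numRealClasses_eq_one (hodd : Odd (Nat.card G)) : numRealClasses G = 1 := by
  simp only [numRealClasses, isRealClass_iff, conjClassesZPow_neg_one_eq_self_iff hodd]
  exact Nat.card_unique

theorem legendreSym_prod_centralizerCard [Fintype (ConjClasses G)] (hodd : Odd (Nat.card G))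
    {q : ℕ} [hq : Fact q.Prime] (hqG : Int.gcd q (Nat.card G) = 1) :
    legendreSym q (∏ C : ConjClasses G, (centralizerCard C : ℤ)) = legendreSym q (Nat.card G) := by
  rw [← legendreSym.hom_apply, map_prod, prod_conjClasses_eq_apply_one hodd, centralizerCard_one]
  · rfl
  intro C _
  have not_dvd : ¬ q ∣ centralizerCard C := fun h =>
    hq.out.coprime_iff_not_dvd.1 hqG (h.trans (centralizerCard_dvd_card C))
  rw [centralizerCard_conjClassesZPow_neg_one, ← sq]
  refine legendreSym.sq_one q ?_
  rwa [Int.cast_natCast, Ne, ZMod.natCast_eq_zero_iff]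

end OddOrder

section CharacterMatrix

variable {G K ι : Type*} [Group G] [Field K] {n : ι → Type*} [∀ i, Fintype (n i)]
  [∀ i, DecidableEq (n i)] (e : MonoidAlgebra K G ≃ₐ[K] ∀ i, Matrix (n i) (n i) K)

/-- The character table of `G` over `K` read off a Wedderburn decomposition `e` of the group
algebra: the row `i` is the trace of the `i`-th block. -/
noncomputable def characterMatrix : Matrix ι (ConjClasses G) K :=
  Matrix.of fun i => Quotient.lift (fun g => (e (MonoidAlgebra.of K G g) i).trace) fun g h hgh => by
    obtain ⟨c, rfl⟩ := isConj_iff.1 (show IsConj g h from hgh)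
    simp only [map_mul, Pi.mul_apply]
    rw [Matrix.trace_mul_comm, ← Pi.mul_apply, ← Pi.mul_apply, ← map_mul, ← map_mul, ← map_mul,
      ← map_mul, inv_mul_cancel_left]

theorem characterMatrix_mk (i : ι) (g : G) :
    characterMatrix e i (ConjClasses.mk g) = (e (MonoidAlgebra.of K G g) i).trace := rfl

theorem characterMatrix_pow_char (p : ℕ) [Fact p.Prime] [CharP K p] (i : ι) (C : ConjClasses G) :
    characterMatrix e i (conjClassesZPow G p C) = characterMatrix e i C ^ p := by
  obtain ⟨g, rfl⟩ := C.exists_rep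
  change characterMatrix e i (ConjClasses.mk (g ^ (p : ℤ))) =
    characterMatrix e i (ConjClasses.mk g) ^ p
  rw [zpow_natCast, characterMatrix_mk, characterMatrix_mk, ← trace_pow_char,
    map_pow, map_pow, Pi.pow_apply]

theorem trace_mulLeftRight_of_algEquiv_pi_matrix [Fintype ι] (a b : MonoidAlgebra K G) :
    LinearMap.trace K _ (LinearMap.mulLeftRight K (a, b)) =
      ∑ i, (e a i).trace * (e b i).trace := by
  have conj_eq : e.toLinearEquiv.conj (LinearMap.mulLeftRight K (a, b)) =
      LinearMap.piMap fun i => LinearMap.mulLeftRight K (e a i, e b i) := by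
    refine LinearMap.ext fun x => funext fun i => ?_
    simp [LinearEquiv.conj_apply]
  rw [← LinearMap.trace_conj' _ e.toLinearEquiv, conj_eq, trace_piMap]
  simp only [trace_mulLeftRight_matrix]

theorem transpose_characterMatrix_mul_self [Fintype ι] [Finite G] [DecidableEq (ConjClasses G)] :
    (characterMatrix e).transpose * characterMatrix e =
      (Matrix.diagonal fun C => (centralizerCard C : K)).submatrix id (conjClassesZPow G (-1)) := by
  classical
  have := Fintype.ofFinite G
  ext ⟨g⟩ ⟨h⟩
  calc ∑ i, (e (MonoidAlgebra.of K G g) i).trace * (e (MonoidAlgebra.of K G h) i).trace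
      = Nat.card {x // g * x * h = x} := by
        rw [← trace_mulLeftRight_of_algEquiv_pi_matrix, trace_mulLeftRight_monoidAlgebra,
          Nat.card_eq_fintype_card]
    _ = _ := by
        rw [card_mul_mul_eq_self, Nat.cast_ite, Nat.cast_zero]
        exact if_congr (eq_comm.trans conjClassesZPow_neg_one_involutive.eq_iff) rfl rfl

theorem linearIndependent_characterMatrix [∀ i, Nonempty (n i)] :
    LinearIndependent K (characterMatrix e).row := by
  classical
  rw [linearIndependent_iff']
  intro s c hc i hi
  have combination_eq_zero : ∑ i ∈ s, c i • (Matrix.traceLinearMap (n i) K K ∘ₗ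
      LinearMap.proj i ∘ₗ e.toLinearMap) = 0 := by
    refine (MonoidAlgebra.basis G K).ext fun g => ?_
    simpa [characterMatrix_mk] using congrFun hc (ConjClasses.mk g)
  let a := Classical.arbitrary (n i)
  have apply_single :=
    LinearMap.congr_fun combination_eq_zero (e.symm (Pi.single i (Matrix.single a a 1)))
  have trace_single (j : ι) : ((Pi.single i (Matrix.single a a 1) :
      ∀ j, Matrix (n j) (n j) K) j).trace = if j = i then 1 else 0 := by
    rcases eq_or_ne j i with rfl | hji <;> simp [*]
  simpa [trace_single, hi] using apply_single

include e in
theorem card_eq_card_conjClasses [Fintype ι] [Finite G] [Fintype (ConjClasses G)]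
    [∀ i, Nonempty (n i)] (hG : (Nat.card G : K) ≠ 0) :
    Fintype.card ι = Fintype.card (ConjClasses G) := by
  classical
  have rank_eq : (characterMatrix e).rank = Fintype.card ι :=
    (linearIndependent_characterMatrix e).rank_matrix
  refine le_antisymm (rank_eq ▸ Matrix.rank_le_card_width _) ?_
  let D : Matrix (ConjClasses G) (ConjClasses G) K := .diagonal fun C => (centralizerCard C : K)
  have isUnit_D : IsUnit D := by
    rw [Matrix.isUnit_diagonal, Pi.isUnit_iff]
    exact fun C => IsUnit.mk0 _ <|
      ne_zero_of_dvd_ne_zero hG (Nat.cast_dvd_cast (centralizerCard_dvd_card C))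
  calc Fintype.card (ConjClasses G) = D.rank := (Matrix.rank_of_isUnit D isUnit_D).symm
    _ = ((characterMatrix e).transpose * characterMatrix e).rank := by
      rw [transpose_characterMatrix_mul_self]
      exact (Matrix.rank_submatrix D (.refl _) conjClassesZPow_neg_one_involutive.toPerm).symm
    _ ≤ (characterMatrix e).rank := Matrix.rank_mul_le_right _ _
    _ = Fintype.card ι := rank_eq

end CharacterMatrix

theorem exists_characterTable (G K : Type*) [Group G] [Finite G] [Fintype (ConjClasses G)]
    [DecidableEq (ConjClasses G)] [Field K] [IsAlgClosed K] (hG : (Nat.card G : K) ≠ 0) :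
    ∃ X : Matrix (ConjClasses G) (ConjClasses G) K,
      X.transpose * X =
        (Matrix.diagonal fun C => (centralizerCard C : K)).submatrix id (conjClassesZPow G (-1)) ∧
      ∀ p [Fact p.Prime] [CharP K p] C D, X C (conjClassesZPow G p D) = X C D ^ p := by
  have : NeZero (Nat.card G : K) := ⟨hG⟩
  obtain ⟨m, d, hd, ⟨e⟩⟩ :=
    IsSemisimpleRing.exists_algEquiv_pi_matrix_of_isAlgClosed K (MonoidAlgebra K G)
  let σ : ConjClasses G ≃ Fin m := Fintype.equivOfCardEq (card_eq_card_conjClasses e hG).symm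
  refine ⟨(characterMatrix e).submatrix σ id, ?_, fun p _ _ C D => ?_⟩
  · rw [Matrix.transpose_submatrix, Matrix.submatrix_mul_equiv, transpose_characterMatrix_mul_self]
    rfl
  · exact characterMatrix_pow_char e p (σ C) D

section QuadraticSymbol

variable {G : Type*} [Group G] [Finite G]

theorem quadraticSymbol_of_gcd_eq_one [Fintype (ConjClasses G)] [DecidableEq (ConjClasses G)]
    {a : ℤ} (ha : Int.gcd a (Nat.card G) = 1) :
    quadraticSymbol G a = Equiv.Perm.sign (conjClassesPerm G a ha) := by
  rw [quadraticSymbol, dif_pos ha]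
  congr!

theorem quadraticSymbol_of_gcd_ne_one {a : ℤ} (ha : Int.gcd a (Nat.card G) ≠ 1) :
    quadraticSymbol G a = 0 :=
  dif_neg ha

theorem quadraticSymbol_eq_one_or_neg_one {a : ℤ} (ha : Int.gcd a (Nat.card G) = 1) :
    quadraticSymbol G a = 1 ∨ quadraticSymbol G a = -1 := by
  classical
  have := Fintype.ofFinite (ConjClasses G)
  rw [quadraticSymbol_of_gcd_eq_one ha]
  exact Int.isUnit_iff.1 (Units.isUnit _)

theorem quadraticSymbol_congr {a b : ℤ} (h : a ≡ b [ZMOD Nat.card G]) :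
    quadraticSymbol G a = quadraticSymbol G b := by
  classical
  have := Fintype.ofFinite (ConjClasses G)
  have gcd_eq : Int.gcd a (Nat.card G) = Int.gcd b (Nat.card G) := by
    rw [← Int.gcd_emod, h, Int.gcd_emod]
  by_cases ha : Int.gcd a (Nat.card G) = 1
  · have hb : Int.gcd b (Nat.card G) = 1 := gcd_eq ▸ ha
    have perm_eq : conjClassesPerm G a ha = conjClassesPerm G b hb :=
      Equiv.ext fun C => congrFun (conjClassesZPow_congr h) C
    rw [quadraticSymbol_of_gcd_eq_one ha, quadraticSymbol_of_gcd_eq_one hb, perm_eq]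
  · rw [quadraticSymbol_of_gcd_ne_one ha, quadraticSymbol_of_gcd_ne_one (gcd_eq ▸ ha)]

theorem neg_one_pow_numComplexPairs : (-1 : ℤ) ^ numComplexPairs G = quadraticSymbol G (-1) := by
  classical
  have := Fintype.ofFinite (ConjClasses G)
  have ha : Int.gcd (-1) (Nat.card G) = 1 := by simp
  have sq_eq_one : conjClassesPerm G (-1) ha ^ 2 = 1 :=
    Equiv.ext conjClassesZPow_neg_one_involutive
  have fixed_equiv : {C : ConjClasses G // IsRealClass C} ≃
      Function.fixedPoints (conjClassesPerm G (-1) ha) :=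
    Equiv.subtypeEquivRight fun _ => isRealClass_iff
  rw [quadraticSymbol_of_gcd_eq_one ha, Equiv.Perm.sign_of_pow_two_eq_one sq_eq_one,
    numComplexPairs, Nat.card_eq_fintype_card, Fintype.card_subtype_compl,
    Fintype.card_congr fixed_equiv]
  norm_cast

theorem det_submatrix_conjClassesZPow [Fintype (ConjClasses G)] [DecidableEq (ConjClasses G)]
    {R : Type*} [CommRing R] {a : ℤ} (ha : Int.gcd a (Nat.card G) = 1)
    (X : Matrix (ConjClasses G) (ConjClasses G) R) :
    (X.submatrix id (conjClassesZPow G a)).det = quadraticSymbol G a * X.det := by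
  rw [quadraticSymbol_of_gcd_eq_one ha]
  exact Matrix.det_permute' (conjClassesPerm G a ha) X

theorem intCast_legendreSym {R : Type*} [Ring R] (q : ℕ) [Fact q.Prime] [CharP R q] (a : ℤ) :
    (legendreSym q a : R) = (a : R) ^ (q / 2) := by
  simpa using congrArg (ZMod.castHom dvd_rfl R) (legendreSym.eq_pow q a)

theorem exists_det_characterTable [Fintype (ConjClasses G)] (K : Type*) [Field K] [IsAlgClosed K]
    (hG : (Nat.card G : K) ≠ 0) :
    ∃ x : K, x ≠ 0 ∧
      x ^ 2 = (quadraticSymbol G (-1) * ∏ C : ConjClasses G, (centralizerCard C : ℤ) : ℤ) ∧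
      ∀ p [Fact p.Prime] [CharP K p], Int.gcd p (Nat.card G) = 1 →
        x ^ p = quadraticSymbol G p * x := by
  classical
  obtain ⟨X, transpose_mul_self, pow_char⟩ := exists_characterTable G K hG
  have det_sq : X.det ^ 2 =
      quadraticSymbol G (-1) * ∏ C : ConjClasses G, (centralizerCard C : K) := by
    rw [← Matrix.det_diagonal, ← det_submatrix_conjClassesZPow (by simp), ← transpose_mul_self,
      Matrix.det_mul, Matrix.det_transpose, sq]
  have prod_ne_zero : ∏ C : ConjClasses G, (centralizerCard C : K) ≠ 0 :=
    Finset.prod_ne_zero_iff.2 fun C _ =>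
      ne_zero_of_dvd_ne_zero hG (Nat.cast_dvd_cast (centralizerCard_dvd_card C))
  refine ⟨X.det, ?_, by exact_mod_cast det_sq, fun p _ _ hp => ?_⟩
  · rw [← pow_ne_zero_iff two_ne_zero, det_sq]
    rcases quadraticSymbol_eq_one_or_neg_one (G := G) (a := -1) (by simp) with h | h <;>
      simpa [h] using prod_ne_zero
  · rw [← det_submatrix_conjClassesZPow hp, ← frobenius_def, RingHom.map_det]
    congr 1
    ext C D
    exact (pow_char p C D).symm

theorem quadraticSymbol_prime [Fintype (ConjClasses G)] {q : ℕ} [hq : Fact q.Prime] (hq2 : q ≠ 2)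
    (hqG : Int.gcd q (Nat.card G) = 1) :
    quadraticSymbol G q =
      legendreSym q (quadraticSymbol G (-1) * ∏ C : ConjClasses G, (centralizerCard C : ℤ)) := by
  let K := AlgebraicClosure (ZMod q)
  have card_ne_zero : (Nat.card G : K) ≠ 0 := by
    rw [Ne, CharP.cast_eq_zero_iff K q, ← hq.out.coprime_iff_not_dvd]
    exact hqG
  obtain ⟨x, x_ne_zero, x_sq, x_pow⟩ := exists_det_characterTable (G := G) K card_ne_zero
  refine Int.cast_injOn_of_ringChar_ne_two (R := K) (by rwa [ringChar.eq K q]) ?_ ?_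
    (mul_right_cancel₀ x_ne_zero ?_)
  · exact Or.inr (quadraticSymbol_eq_one_or_neg_one hqG)
  · rw [jacobiSym.legendreSym.to_jacobiSym]
    exact jacobiSym.trichotomy _ q
  · rw [← x_pow q hqG, intCast_legendreSym, ← x_sq, ← pow_mul, ← pow_succ,
      Nat.two_mul_div_two_add_one_of_odd (hq.out.odd_of_ne_two hq2)]

end QuadraticSymbol

section OddOrder

variable {G : Type*} [Group G] [Finite G]

theorem quadraticSymbol_neg_one (hodd : Odd (Nat.card G)) :
    quadraticSymbol G (-1) = (-1) ^ ((Nat.card G - 1) / 2) := by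
  classical
  have := Fintype.ofFinite (ConjClasses G)
  have numComplexPairs_eq : numComplexPairs G = (Nat.card (ConjClasses G) - 1) / 2 := by
    rw [← numRealClasses_eq_one hodd, numComplexPairs, numRealClasses, Nat.card_eq_fintype_card,
      Nat.card_eq_fintype_card, Nat.card_eq_fintype_card, Fintype.card_subtype_compl]
  have modEq_four : Nat.card (ConjClasses G) % 4 = Nat.card G % 4 :=
    card_conjClasses_modEq_card hodd
  rw [← neg_one_pow_numComplexPairs, numComplexPairs_eq, neg_one_pow_eq_pow_mod_two,
    neg_one_pow_eq_pow_mod_two (n := (Nat.card G - 1) / 2)]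
  rw [Nat.odd_iff] at hodd
  congr 1
  omega

theorem groupDiscriminant_eq_nStar (hodd : Odd (Nat.card G)) :
    groupDiscriminant G = (nStar (Nat.card G) : ℚ) := by
  have neg_one_pow_eq : (-1 : ℚ) ^ numComplexPairs G = (-1) ^ ((Nat.card G - 1) / 2) := by
    exact_mod_cast neg_one_pow_numComplexPairs.trans (quadraticSymbol_neg_one hodd)
  rw [groupDiscriminant, neg_one_pow_eq, numRealClasses_eq_one hodd, pow_one,
    finprod_eq_one_of_forall_eq_one, mul_one, nStar]
  · push_cast
    rfl
  · rintro ⟨C, hC⟩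
    rw [isRealClass_iff, conjClassesZPow_neg_one_eq_self_iff hodd] at hC
    simp only [hC, card_carrier_one, Nat.cast_one, inv_one]

theorem quadraticSymbol_prime_of_odd (hodd : Odd (Nat.card G)) {q : ℕ} [hq : Fact q.Prime]
    (hq2 : q ≠ 2) (hqG : Int.gcd q (Nat.card G) = 1) :
    quadraticSymbol G q = legendreSym q (nStar (Nat.card G)) := by
  have := Fintype.ofFinite (ConjClasses G)
  rw [quadraticSymbol_prime hq2 hqG, legendreSym.mul,
    legendreSym_prod_centralizerCard hodd hqG, quadraticSymbol_neg_one hodd, ← legendreSym.mul,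
    nStar]

theorem quadraticSymbol_eq_jacobiSym (hodd : Odd (Nat.card G)) (a : ℤ) :
    quadraticSymbol G a = jacobiSym a (Nat.card G) := by
  by_cases ha : Int.gcd a (Nat.card G) = 1
  · obtain ⟨q, two_lt, hq, hqa⟩ := Nat.forall_exists_prime_gt_and_zmodEq 2
      hodd.pos.ne' (Int.isCoprime_iff_gcd_eq_one.2 ha)
    have : Fact q.Prime := ⟨hq⟩
    have hqG : Int.gcd q (Nat.card G) = 1 := by
      rw [← Int.gcd_emod, hqa, Int.gcd_emod, ha]
    rw [quadraticSymbol_congr hqa.symm, quadraticSymbol_prime_of_odd hodd two_lt.ne' hqG,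
      jacobiSym.legendreSym.to_jacobiSym, jacobiSym_nStar hodd (hq.odd_of_ne_two two_lt.ne'),
      jacobiSym.mod_left' hqa]
  · rw [quadraticSymbol_of_gcd_ne_one ha, jacobiSym.eq_zero_iff.2 ⟨hodd.pos.ne', ha⟩]

end OddOrder

theorem corollary1 (G : Type*) [Group G] [Finite G] (hodd : Odd (Nat.card G)) :
    groupDiscriminant G = (nStar (Nat.card G) : ℚ) ∧
    (∀ a : ℤ, quadraticSymbol G a = kroneckerSymbol (nStar (Nat.card G)) a) ∧
    ((∀ a : ℤ, Int.gcd a (Nat.card G) = 1 → quadraticSymbol G a = 1) ↔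
      IsSquare (Nat.card G)) := by
  refine ⟨groupDiscriminant_eq_nStar hodd, fun a => ?_, ?_⟩
  · rw [quadraticSymbol_eq_jacobiSym hodd, kroneckerSymbol_nStar hodd]
  · simp only [quadraticSymbol_eq_jacobiSym hodd]
    exact forall_jacobiSym_eq_one_iff_isSquare hodd
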